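/- All Banach spaces are real. Let $1\le p<\infty$. For a Banach space $E$ with dual $E^*$ and a tuple $(x_j^*)_{j=1}^n$ in $E^*$, put $\|(x_j^*)_{j=1}^n\|_{p,\mathrm{weak}}=\sup_{\|x\|\le 1}\bigl(\sum_{j=1}^n|x_j^*(x)|^p\bigr)^{1/p}$. For a positively homogeneous function $f\colon E^*\to\mathbb R$ (that is, $f(\lambda x^*)=\lambda f(x^*)$ for all $\lambda\ge 0$ and $x^*\in E^*$), put $$\|f\|_{\mathrm{FBL}^p[E]}=\sup\Bigl\{\Bigl(\sum_{j=1}^n|f(x_j^*)|^p\Bigr)^{1/p} : n\in\mathbb N,\ (x_j^*)_{j=1}^n\subset E^*,\ \|(x_j^*)_{j=1}^n\|_{p,\mathrm{weak}}\le 1\Bigr\}.$$ Let $H^p[E]$ be the Banach lattice of all positively homogeneous functions $f\colon E^*\to\mathbb R$ with $\|f\|_{\mathrm{FBL}^p[E]}<\infty$, with this norm and the pointwise vector lattice operations, and let $\mathrm{FBL}^p[E]$ be the closed sublattice of $H^p[E]$ generated by the evaluations $\delta_x\colon x^*\mapsto x^*(x)$, $x\in E$. An isomorphic embedding between Banach spaces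 is a bounded linear operator which is injective and has closed range. For a bounded linear operator $J\colon E\to F$ between Banach spaces with adjoint $J^*\colon F^*\to E^*$, let $C_{J^*}\colon H^p[E]\to H^p[F]$ be the composition operator $f\mapsto f\circ J^*$, and let $\overline J\colon \mathrm{FBL}^p[E]\to\mathrm{FBL}^p[F]$ be the unique bounded lattice homomorphism such that $\overline J(\delta_x)=\delta_{Jx}$ for all $x\in E$. **Proposition.** Let $J\colon E\to F$ be an isomorphic embedding of a Banach space $E$ into a Banach space $F$, and let $1\le p<\infty$. The following conditions are equivalent: (a) There is a constant $C\ge 1$ such that, for every $n\in\mathbb N$, every bounded linear operator $S\colon E\to\ell_p^n$ admits a bounded linear extension $\widetilde S\colon F\to\ell_p^n$ (in the sense that $S=\widetilde S J$) with $\|\widetilde S\|\le C\|S\|$. (b) The lattice homomorphism $\overline J$ is an isomorphic embedding of $\mathrm{FBL}^p[E]$ into $\mathrm{FBL}^p[F]$. (c) The lattice homomorphism $C_{J^*}$ is an isomorphic embedding of $H^p[E]$ into $H^p[F]$. -/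

import Mathlib

open scoped ENNReal

namespace FreeBanachLattice

section IsomorphicEmbedding

/-- An isomorphic embedding of normed spaces: a bounded linear operator which is injective and
has closed range. -/
def IsIsomorphicEmbedding {X Y : Type*} [NormedAddCommGroup X] [NormedSpace ℝ X]
    [NormedAddCommGroup Y] [NormedSpace ℝ Y] (T : X →L[ℝ] Y) : Prop :=
  Function.Injective T ∧ IsClosed (Set.range T)

end IsomorphicEmbedding

section LatticeHom

/-- A lattice homomorphism between vector lattices: a linear map that preserves the
lattice operations. -/
def IsLatticeHom {X Y : Type*} [AddCommGroup X] [Module ℝ X] [Lattice X]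
    [AddCommGroup Y] [Module ℝ Y] [Lattice Y] (T : X →ₗ[ℝ] Y) : Prop :=
  (∀ f g, T (f ⊔ g) = T f ⊔ T g) ∧ (∀ f g, T (f ⊓ g) = T f ⊓ T g)

end LatticeHom

section Norms

variable {E : Type*} [NormedAddCommGroup E] [NormedSpace ℝ E]

/-- The weak `p`-summing norm of an `n`-tuple of functionals: the supremum over the closed unit
ball of `E` of the `ℓ_p^n`-norm of `(x*_j(x))_j`. -/
noncomputable def weakNorm (p : ℝ≥0∞) [Fact (1 ≤ p)] {n : ℕ}
    (xs : Fin n → StrongDual ℝ E) : ℝ≥0∞ :=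
  ⨆ (x : E) (_ : ‖x‖ ≤ 1), ‖WithLp.toLp p (fun j => xs j x)‖ₑ

/-- The norm `‖f‖_{FBL^p[E]}` (with values in `[0, ∞]`) of a function `f : E* → ℝ`: the supremum
of the `ℓ_p^n`-norms of `(f(x*_j))_j` over all finite tuples in `E*` of weak `p`-summing norm
at most one. -/
noncomputable def fblNorm (p : ℝ≥0∞) [Fact (1 ≤ p)] (f : StrongDual ℝ E → ℝ) : ℝ≥0∞ :=
  ⨆ (n : ℕ) (xs : Fin n → StrongDual ℝ E) (_ : weakNorm p xs ≤ 1),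
    ‖WithLp.toLp p (fun j => f (xs j))‖ₑ

variable {p : ℝ≥0∞} [Fact (1 ≤ p)]

theorem enorm_le_weakNorm {n : ℕ} (xs : Fin n → StrongDual ℝ E) {x : E} (hx : ‖x‖ ≤ 1) :
    ‖WithLp.toLp p (fun j => xs j x)‖ₑ ≤ weakNorm p xs :=
  le_iSup_of_le (f := fun x : E => ⨆ _ : ‖x‖ ≤ 1, ‖WithLp.toLp p (fun j => xs j x)‖ₑ) x
    (le_iSup_of_le hx le_rfl)

theorem enorm_le_fblNorm (f : StrongDual ℝ E → ℝ) {n : ℕ} {xs : Fin n → StrongDual ℝ E}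
    (h : weakNorm p xs ≤ 1) : ‖WithLp.toLp p (fun j => f (xs j))‖ₑ ≤ fblNorm p f :=
  le_iSup_of_le n (le_iSup_of_le xs (le_iSup_of_le h le_rfl))

theorem fblNorm_le {f : StrongDual ℝ E → ℝ} {C : ℝ≥0∞}
    (h : ∀ (n : ℕ) (xs : Fin n → StrongDual ℝ E), weakNorm p xs ≤ 1 →
      ‖WithLp.toLp p (fun j => f (xs j))‖ₑ ≤ C) : fblNorm p f ≤ C :=
  iSup_le fun n => iSup_le fun xs => iSup_le fun hx => h n xs hx

theorem fblNorm_add_le (f g : StrongDual ℝ E → ℝ) :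
    fblNorm p (f + g) ≤ fblNorm p f + fblNorm p g := by
  refine fblNorm_le fun n xs hx => ?_
  refine le_trans ?_ (add_le_add (enorm_le_fblNorm f hx) (enorm_le_fblNorm g hx))
  exact enorm_add_le (WithLp.toLp p (fun j => f (xs j))) (WithLp.toLp p (fun j => g (xs j)))

theorem fblNorm_smul_le (c : ℝ) (f : StrongDual ℝ E → ℝ) :
    fblNorm p (c • f) ≤ ‖c‖ₑ * fblNorm p f := by
  refine fblNorm_le fun n xs hx => ?_
  refine le_trans ?_ (mul_le_mul_right (enorm_le_fblNorm f hx) _)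
  exact (enorm_smul c (WithLp.toLp p (fun j => f (xs j)))).le

theorem norm_toLp_mono {n : ℕ} {a b : Fin n → ℝ} (h : ∀ j, |a j| ≤ |b j|) :
    ‖WithLp.toLp p a‖ ≤ ‖WithLp.toLp p b‖ := by
  rcases eq_or_ne p ∞ with rfl | hp
  · rw [PiLp.norm_eq_ciSup, PiLp.norm_eq_ciSup]
    exact ciSup_mono (Set.finite_range _).bddAbove fun j => by simpa using h j
  · have h1 : 1 ≤ p := Fact.out
    have hp0 : 0 < p.toReal := ENNReal.toReal_pos (zero_lt_one.trans_le h1).ne' hp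
    rw [PiLp.norm_eq_sum hp0, PiLp.norm_eq_sum hp0]
    refine Real.rpow_le_rpow (Finset.sum_nonneg fun j _ => by positivity) ?_ (by positivity)
    exact Finset.sum_le_sum fun j _ =>
      Real.rpow_le_rpow (norm_nonneg _) (by simpa using h j) hp0.le

theorem fblNorm_mono {f g : StrongDual ℝ E → ℝ} (h : ∀ x, |f x| ≤ |g x|) :
    fblNorm p f ≤ fblNorm p g := by
  refine fblNorm_le fun n xs hx => le_trans ?_ (enorm_le_fblNorm g hx)
  rw [enorm_le_iff_norm_le]
  exact norm_toLp_mono fun j => h _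

theorem norm_toLp_abs {n : ℕ} (a : Fin n → ℝ) :
    ‖WithLp.toLp p (fun j => |a j|)‖ = ‖WithLp.toLp p a‖ :=
  le_antisymm (norm_toLp_mono fun j => by simp) (norm_toLp_mono fun j => by simp)

theorem fblNorm_abs (f : StrongDual ℝ E → ℝ) : fblNorm p (fun x => |f x|) = fblNorm p f :=
  le_antisymm (fblNorm_mono fun j => by simp) (fblNorm_mono fun j => by simp)

theorem fblNorm_lt_top_of_le {f g h : StrongDual ℝ E → ℝ} (hg : fblNorm p g < ∞)
    (hh : fblNorm p h < ∞) (H : ∀ x, |f x| ≤ |g x| + |h x|) : fblNorm p f < ∞ := by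
  refine lt_of_le_of_lt (b := fblNorm p ((fun x => |g x|) + fun x => |h x|)) ?_ ?_
  · refine fblNorm_mono fun x => (H x).trans (le_abs_self _)
  · refine (fblNorm_add_le _ _).trans_lt ?_
    rw [fblNorm_abs, fblNorm_abs]
    exact ENNReal.add_lt_top.2 ⟨hg, hh⟩

theorem weakNorm_single (x : StrongDual ℝ E) (hx : ‖x‖ ≤ 1) :
    weakNorm p (fun _ : Fin 1 => x) ≤ 1 := by
  refine iSup_le fun v => iSup_le fun hv => ?_
  rw [← enorm_one (G := ℝ), enorm_le_iff_norm_le]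
  have h1 : WithLp.toLp p (fun _ : Fin 1 => x v) = PiLp.single p 0 (x v) := by
    ext j; fin_cases j; simp
  rw [h1, PiLp.norm_single, norm_one]
  calc ‖x v‖ ≤ ‖x‖ * ‖v‖ := x.le_opNorm v
    _ ≤ 1 * 1 := by gcongr
    _ = 1 := one_mul 1

end Norms

/-- `H^p[E]`: the positively homogeneous functions `f : E* → ℝ` with `‖f‖_{FBL^p[E]} < ∞`. -/
structure Hp (p : ℝ≥0∞) [Fact (1 ≤ p)] (E : Type*) [NormedAddCommGroup E] [NormedSpace ℝ E] where
  /-- the underlying function on the dual space -/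
  toFun : StrongDual ℝ E → ℝ
  posHom' : ∀ (c : ℝ), 0 ≤ c → ∀ x, toFun (c • x) = c * toFun x
  finite' : fblNorm p toFun < ∞

namespace Hp

variable {p : ℝ≥0∞} [Fact (1 ≤ p)] {E : Type*} [NormedAddCommGroup E] [NormedSpace ℝ E]

instance : FunLike (Hp p E) (StrongDual ℝ E) ℝ where
  coe := Hp.toFun
  coe_injective := fun f g h => by cases f; cases g; congr

theorem posHom (f : Hp p E) {c : ℝ} (hc : 0 ≤ c) (x : StrongDual ℝ E) : f (c • x) = c * f x :=
  f.posHom' c hc x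

theorem finite (f : Hp p E) : fblNorm p f < ∞ := f.finite'

@[ext] theorem ext {f g : Hp p E} (h : ∀ x, f x = g x) : f = g := DFunLike.ext f g h

instance : Zero (Hp p E) :=
  ⟨⟨0, by simp, lt_of_le_of_lt (fblNorm_le (C := 0) fun n xs _ => by
    have h0 : WithLp.toLp p (fun j => (0 : StrongDual ℝ E → ℝ) (xs j)) = 0 := rfl
    rw [h0, enorm_zero]) (by simp)⟩⟩

instance : Add (Hp p E) :=
  ⟨fun f g => ⟨f + g, fun c hc x => by simp [posHom _ hc, mul_add],
    (fblNorm_add_le _ _).trans_lt (ENNReal.add_lt_top.2 ⟨f.finite, g.finite⟩)⟩⟩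

theorem smul_finite (c : ℝ) (f : Hp p E) : fblNorm p (c • (f : StrongDual ℝ E → ℝ)) < ∞ :=
  (fblNorm_smul_le c f).trans_lt (ENNReal.mul_lt_top (by simp) f.finite)

instance : SMul ℝ (Hp p E) :=
  ⟨fun c f => ⟨c • (f : StrongDual ℝ E → ℝ), fun a ha x => by simp [posHom _ ha]; ring,
    smul_finite c f⟩⟩

instance : Neg (Hp p E) :=
  ⟨fun f => ⟨-f, fun a ha x => by simp [posHom _ ha],
    lt_of_le_of_lt (fblNorm_mono fun x => by simp) f.finite⟩⟩

instance : Sub (Hp p E) :=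
  ⟨fun f g => ⟨f - g, fun a ha x => by simp [posHom _ ha, mul_sub],
    fblNorm_lt_top_of_le f.finite g.finite fun x => abs_sub _ _⟩⟩

instance : Max (Hp p E) :=
  ⟨fun f g => ⟨fun x => f x ⊔ g x, fun a ha x => by
      simp [posHom _ ha, mul_max_of_nonneg _ _ ha],
    fblNorm_lt_top_of_le f.finite g.finite fun x => by
      rcases max_choice (f x) (g x) with h | h <;> rw [h] <;> simp⟩⟩

instance : Min (Hp p E) :=
  ⟨fun f g => ⟨fun x => f x ⊓ g x, fun a ha x => by
      simp [posHom _ ha, mul_min_of_nonneg _ _ ha],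
    fblNorm_lt_top_of_le f.finite g.finite fun x => by
      rcases min_choice (f x) (g x) with h | h <;> rw [h] <;> simp⟩⟩

instance : LE (Hp p E) := ⟨fun f g => ∀ x, f x ≤ g x⟩

instance : LT (Hp p E) := ⟨fun f g => f ≤ g ∧ ¬ g ≤ f⟩

instance : SMul ℕ (Hp p E) :=
  ⟨fun n f => ⟨n • (f : StrongDual ℝ E → ℝ), fun a ha x => by simp [posHom _ ha]; ring, by
    have h : n • (f : StrongDual ℝ E → ℝ) = (n : ℝ) • (f : StrongDual ℝ E → ℝ) := by
      ext x; simp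
    rw [h]; exact smul_finite (n : ℝ) f⟩⟩

instance : SMul ℤ (Hp p E) :=
  ⟨fun n f => ⟨n • (f : StrongDual ℝ E → ℝ), fun a ha x => by simp [posHom _ ha]; ring, by
    have h : n • (f : StrongDual ℝ E → ℝ) = (n : ℝ) • (f : StrongDual ℝ E → ℝ) := by
      ext x; simp
    rw [h]; exact smul_finite (n : ℝ) f⟩⟩

instance : AddCommGroup (Hp p E) :=
  Function.Injective.addCommGroup (fun f : Hp p E => (f : StrongDual ℝ E → ℝ))
    DFunLike.coe_injective rfl (fun _ _ => rfl) (fun _ => rfl) (fun _ _ => rfl)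
    (fun _ _ => rfl) (fun _ _ => rfl)

/-- The inclusion of `H^p[E]` into the space of all functions on the dual space. -/
def coeHom : Hp p E →+ (StrongDual ℝ E → ℝ) where
  toFun f := f
  map_zero' := rfl
  map_add' _ _ := rfl

instance : Module ℝ (Hp p E) :=
  Function.Injective.module ℝ coeHom DFunLike.coe_injective fun _ _ => rfl

/-- The pointwise vector lattice operations. -/
instance : Lattice (Hp p E) :=
  Function.Injective.lattice (fun f : Hp p E => (f : StrongDual ℝ E → ℝ))
    DFunLike.coe_injective Iff.rfl (Iff.of_eq rfl) (fun _ _ => rfl) (fun _ _ => rfl)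

@[simp] theorem zero_apply (x : StrongDual ℝ E) : (0 : Hp p E) x = 0 := rfl
@[simp] theorem add_apply (f g : Hp p E) (x : StrongDual ℝ E) : (f + g) x = f x + g x := rfl
@[simp] theorem neg_apply (f : Hp p E) (x : StrongDual ℝ E) : (-f) x = -f x := rfl
@[simp] theorem sub_apply (f g : Hp p E) (x : StrongDual ℝ E) : (f - g) x = f x - g x := rfl
@[simp] theorem smul_apply (c : ℝ) (f : Hp p E) (x : StrongDual ℝ E) : (c • f) x = c * f x := rfl
@[simp] theorem sup_apply (f g : Hp p E) (x : StrongDual ℝ E) : (f ⊔ g) x = f x ⊔ g x := rfl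
@[simp] theorem inf_apply (f g : Hp p E) (x : StrongDual ℝ E) : (f ⊓ g) x = f x ⊓ g x := rfl
@[simp] theorem abs_apply (f : Hp p E) (x : StrongDual ℝ E) : |f| x = |f x| := rfl
theorem le_def (f g : Hp p E) : f ≤ g ↔ ∀ x, f x ≤ g x := Iff.rfl

noncomputable instance : Norm (Hp p E) := ⟨fun f => (fblNorm p f).toReal⟩

theorem norm_def (f : Hp p E) : ‖f‖ = (fblNorm p f).toReal := rfl

theorem norm_toLp_le (f : Hp p E) {n : ℕ} {xs : Fin n → StrongDual ℝ E}
    (h : weakNorm p xs ≤ 1) : ‖WithLp.toLp p (fun j => f (xs j))‖ ≤ ‖f‖ := by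
  rw [norm_def, ← toReal_enorm]
  exact ENNReal.toReal_mono f.finite.ne (enorm_le_fblNorm _ h)

theorem norm_le (f : Hp p E) {C : ℝ} (hC : 0 ≤ C)
    (h : ∀ (n : ℕ) (xs : Fin n → StrongDual ℝ E), weakNorm p xs ≤ 1 →
      ‖WithLp.toLp p (fun j => f (xs j))‖ ≤ C) : ‖f‖ ≤ C := by
  rw [norm_def]
  refine ENNReal.toReal_le_of_le_ofReal hC (fblNorm_le fun n xs hx => ?_)
  rw [← ofReal_norm]
  exact ENNReal.ofReal_le_ofReal (h n xs hx)

theorem norm_nonneg' (f : Hp p E) : 0 ≤ ‖f‖ := ENNReal.toReal_nonneg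

theorem abs_apply_le (f : Hp p E) (x : StrongDual ℝ E) : |f x| ≤ ‖f‖ * ‖x‖ := by
  have key : ∀ y : StrongDual ℝ E, ‖y‖ ≤ 1 → |f y| ≤ ‖f‖ := fun y hy => by
    have h := norm_toLp_le f (weakNorm_single (p := p) y hy)
    have h1 : WithLp.toLp p (fun _ : Fin 1 => f y) = PiLp.single p 0 (f y) := by
      ext j; fin_cases j; simp
    rwa [h1, PiLp.norm_single] at h
  rcases eq_or_ne x 0 with rfl | hx
  · have := f.posHom le_rfl (0 : StrongDual ℝ E)
    simp at this
    simp [this]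
  · have hx' : 0 < ‖x‖ := norm_pos_iff.2 hx
    have h := key (‖x‖⁻¹ • x) (by rw [norm_smul, norm_inv, norm_norm, inv_mul_cancel₀ hx'.ne'])
    rw [f.posHom (by positivity), abs_mul, abs_of_pos (inv_pos.2 hx'), inv_mul_le_iff₀ hx'] at h
    linarith

/-- `H^p[E]` is normed by `‖f‖_{FBL^p[E]}`. -/
noncomputable instance : NormedAddCommGroup (Hp p E) :=
  AddGroupNorm.toNormedAddCommGroup
    { toFun := fun f => ‖f‖
      map_zero' := le_antisymm (norm_le _ le_rfl fun n xs _ => by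
        have h0 : WithLp.toLp p (fun j => (0 : Hp p E) (xs j)) = 0 := rfl
        rw [h0, norm_zero]) (norm_nonneg' _)
      add_le' := fun f g => norm_le _ (add_nonneg (norm_nonneg' f) (norm_nonneg' g))
        fun n xs hx => (norm_add_le (WithLp.toLp p (fun j => f (xs j)))
          (WithLp.toLp p (fun j => g (xs j)))).trans
            (add_le_add (norm_toLp_le f hx) (norm_toLp_le g hx))
      neg' := fun f => congrArg ENNReal.toReal
        (le_antisymm (fblNorm_mono fun x => by simp) (fblNorm_mono fun x => by simp))
      eq_zero_of_map_eq_zero' := fun f hf => by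
        ext x
        have h := abs_apply_le f x
        change ‖f‖ = 0 at hf
        rw [hf, zero_mul] at h
        simpa using h }

noncomputable instance : NormedSpace ℝ (Hp p E) where
  norm_smul_le c f := norm_le _ (mul_nonneg (norm_nonneg _) (norm_nonneg' f)) fun n xs hx => by
    refine le_trans ?_ (mul_le_mul_of_nonneg_left (norm_toLp_le f hx) (norm_nonneg _))
    exact (norm_smul c (WithLp.toLp p (fun j => f (xs j)))).le

instance : IsOrderedAddMonoid (Hp p E) where
  add_le_add_left _ _ h c x := by simpa using h x

instance : HasSolidNorm (Hp p E) where
  solid _ g h := norm_le _ (norm_nonneg _) fun _ xs hx =>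
    (norm_toLp_mono fun j => h (xs j)).trans (norm_toLp_le g hx)

theorem cauchySeq_apply {u : ℕ → Hp p E} (hu : CauchySeq u) (x : StrongDual ℝ E) :
    CauchySeq fun n => u n x := by
  rw [Metric.cauchySeq_iff'] at hu ⊢
  intro ε hε
  have hx : 0 < ‖x‖ + 1 := by positivity
  obtain ⟨N, hN⟩ := hu (ε / (‖x‖ + 1)) (div_pos hε hx)
  refine ⟨N, fun n hn => ?_⟩
  have h1 := hN n hn
  rw [dist_eq_norm, lt_div_iff₀ hx] at h1
  rw [Real.dist_eq]
  have h2 := abs_apply_le (u n - u N) x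
  have h3 : 0 ≤ ‖u n - u N‖ := norm_nonneg' _
  rw [sub_apply] at h2
  linarith

theorem norm_toLp_sub_le {u : ℕ → Hp p E} {g : StrongDual ℝ E → ℝ}
    (hg : ∀ x, Filter.Tendsto (fun n => u n x) Filter.atTop (nhds (g x)))
    {ε : ℝ} {n N : ℕ} (h : ∀ k ≥ N, ‖u n - u k‖ ≤ ε) {m : ℕ} {xs : Fin m → StrongDual ℝ E}
    (hx : weakNorm p xs ≤ 1) : ‖WithLp.toLp p (fun j => u n (xs j) - g (xs j))‖ ≤ ε := by
  have hlim : Filter.Tendsto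
      (fun k => ‖WithLp.toLp p (fun j => u n (xs j) - u k (xs j))‖) Filter.atTop
      (nhds ‖WithLp.toLp p (fun j => u n (xs j) - g (xs j))‖) := by
    have h1 : Filter.Tendsto (fun k j => u n (xs j) - u k (xs j)) Filter.atTop
        (nhds fun j => u n (xs j) - g (xs j)) :=
      tendsto_pi_nhds.2 fun j => (hg (xs j)).const_sub _
    exact (((PiLp.continuous_toLp p fun _ : Fin m => ℝ).tendsto _).comp h1).norm
  refine le_of_tendsto hlim (Filter.eventually_atTop.2 ⟨N, fun k hk => ?_⟩)
  exact (norm_toLp_le (u n - u k) hx).trans (h k hk)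

instance : CompleteSpace (Hp p E) := by
  refine Metric.complete_of_cauchySeq_tendsto fun u hu => ?_
  choose g hg using fun x => cauchySeq_tendsto_of_complete (cauchySeq_apply hu x)
  have hghom : ∀ (c : ℝ), 0 ≤ c → ∀ x, g (c • x) = c * g x := fun c hc x => by
    have h1 := (hg x).const_mul c
    simp only [← posHom _ hc] at h1
    exact tendsto_nhds_unique (hg (c • x)) h1
  have key : ∀ ε > 0, ∃ N, ∀ n ≥ N, ∀ (m : ℕ) (xs : Fin m → StrongDual ℝ E),
      weakNorm p xs ≤ 1 → ‖WithLp.toLp p (fun j => u n (xs j) - g (xs j))‖ ≤ ε := by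
    intro ε hε
    obtain ⟨N, hN⟩ := Metric.cauchySeq_iff.1 hu ε hε
    refine ⟨N, fun n hn m xs hx => norm_toLp_sub_le (N := N) hg (fun k hk => ?_) hx⟩
    rw [← dist_eq_norm]
    exact (hN n hn k hk).le
  have hgfin : fblNorm p g < ∞ := by
    obtain ⟨N, hN⟩ := key 1 one_pos
    have h1 : fblNorm p (fun x => u N x - g x) < ∞ := by
      refine lt_of_le_of_lt (fblNorm_le (C := 1) fun m xs hx => ?_) (by simp)
      rw [← enorm_one (G := ℝ), enorm_le_iff_norm_le, norm_one]
      exact hN N le_rfl m xs hx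
    refine fblNorm_lt_top_of_le (u N).finite h1 fun x => ?_
    have := abs_sub (u N x) (u N x - g x)
    rwa [sub_sub_cancel] at this
  obtain ⟨G, hG⟩ : ∃ G : Hp p E, ∀ x, G x = g x := ⟨⟨g, hghom, hgfin⟩, fun _ => rfl⟩
  refine ⟨G, Metric.tendsto_atTop.2 fun ε hε => ?_⟩
  obtain ⟨N, hN⟩ := key (ε / 2) (half_pos hε)
  refine ⟨N, fun n hn => ?_⟩
  rw [dist_eq_norm]
  refine lt_of_le_of_lt (norm_le _ (half_pos hε).le fun m xs hx => ?_) (half_lt_self hε)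
  have h2 := hN n hn m xs hx
  simpa only [sub_apply, hG] using h2

/-- The evaluation `δ_x : E* → ℝ`, `δ_x(x*) = x*(x)`, as an element of `H^p[E]`. -/
def delta (p : ℝ≥0∞) [Fact (1 ≤ p)] (x : E) : Hp p E where
  toFun xs := xs x
  posHom' c _ xs := by simp
  finite' := by
    refine lt_of_le_of_lt (fblNorm_le (C := ‖‖x‖ + 1‖ₑ * 1) fun n xs hx => ?_) (by simp)
    have hpos : 0 < ‖x‖ + 1 := by positivity
    have hball : ‖(‖x‖ + 1)⁻¹ • x‖ ≤ 1 := by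
      rw [norm_smul, norm_inv, Real.norm_of_nonneg hpos.le, inv_mul_le_iff₀ hpos]
      linarith
    have h1 : ‖WithLp.toLp p (fun j => xs j ((‖x‖ + 1)⁻¹ • x))‖ₑ ≤ 1 :=
      (enorm_le_weakNorm xs hball).trans hx
    have h2 : WithLp.toLp p (fun j => xs j x) =
        (‖x‖ + 1) • WithLp.toLp p (fun j => xs j ((‖x‖ + 1)⁻¹ • x)) := by
      ext j
      simp [mul_inv_cancel_left₀ hpos.ne']
    rw [h2, enorm_smul]
    exact mul_le_mul_right h1 _

@[simp] theorem delta_apply (x : E) (xs : StrongDual ℝ E) : delta p x xs = xs x := rfl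

variable {F : Type*} [NormedAddCommGroup F] [NormedSpace ℝ F]

theorem weakNorm_precomp_le (S : E →L[ℝ] F) {n : ℕ} {ys : Fin n → StrongDual ℝ F}
    (hy : weakNorm p ys ≤ 1) {c : ℝ} (hc : 0 < c) (hS : ‖S‖ ≤ c) :
    weakNorm p (fun j => c⁻¹ • S.precomp ℝ (ys j)) ≤ 1 := by
  refine iSup_le fun x => iSup_le fun hx => ?_
  have hb : ‖c⁻¹ • S x‖ ≤ 1 := by
    rw [norm_smul, norm_inv, Real.norm_of_nonneg hc.le, inv_mul_le_iff₀ hc, mul_one]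
    calc ‖S x‖ ≤ ‖S‖ * ‖x‖ := S.le_opNorm x
      _ ≤ c * 1 := by gcongr
      _ = c := mul_one c
  refine le_trans (le_of_eq ?_) ((enorm_le_weakNorm ys hb).trans hy)
  congr 2
  funext j
  simp

theorem norm_toLp_precomp_le (S : E →L[ℝ] F) (f : Hp p E) {n : ℕ} {ys : Fin n → StrongDual ℝ F}
    (hy : weakNorm p ys ≤ 1) {c : ℝ} (hc : 0 < c) (hS : ‖S‖ ≤ c) :
    ‖WithLp.toLp p (fun j => f (S.precomp ℝ (ys j)))‖ ≤ c * ‖f‖ := by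
  have h1 := norm_toLp_le f (weakNorm_precomp_le S hy hc hS)
  have h2 : WithLp.toLp p (fun j => f (S.precomp ℝ (ys j))) =
      c • WithLp.toLp p (fun j => f (c⁻¹ • S.precomp ℝ (ys j))) := by
    ext j
    simp [posHom f (inv_nonneg.2 hc.le), mul_inv_cancel_left₀ hc.ne']
  rw [h2, norm_smul, Real.norm_of_nonneg hc.le]
  gcongr

/-- The composition operator `C_{S*} : H^p[E] → H^p[F]`, `f ↦ f ∘ S*`, for a bounded linear
operator `S : E → F` with adjoint `S* : F* → E*`, `S* y* = y* ∘ S`. -/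
noncomputable def compAdjoint (p : ℝ≥0∞) [Fact (1 ≤ p)] (S : E →L[ℝ] F) : Hp p E →L[ℝ] Hp p F :=
  LinearMap.mkContinuousOfExistsBound
    { toFun := fun f =>
        { toFun := fun y => f (S.precomp ℝ y)
          posHom' := fun c hc y => by rw [map_smul, f.posHom hc]
          finite' := by
            refine lt_of_le_of_lt (fblNorm_le (C := ‖(‖S‖ + 1) * ‖f‖‖ₑ) fun n ys hy => ?_)
              enorm_lt_top
            rw [enorm_le_iff_norm_le]
            exact (norm_toLp_precomp_le S f hy (by positivity) (by linarith)).trans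
              (le_abs_self _) }
      map_add' := fun _ _ => rfl
      map_smul' := fun _ _ => rfl }
    ⟨‖S‖ + 1, fun f => norm_le _ (by positivity) fun _ _ hy =>
      norm_toLp_precomp_le S f hy (by positivity) (by linarith)⟩

@[simp] theorem compAdjoint_apply (S : E →L[ℝ] F) (f : Hp p E) (y : StrongDual ℝ F) :
    compAdjoint p S f y = f (S.precomp ℝ y) := rfl

theorem compAdjoint_isLatticeHom (S : E →L[ℝ] F) :
    IsLatticeHom (compAdjoint p S : Hp p E →ₗ[ℝ] Hp p F) :=
  ⟨fun _ _ => rfl, fun _ _ => rfl⟩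

theorem compAdjoint_delta (S : E →L[ℝ] F) (x : E) :
    compAdjoint p S (delta p x) = delta p (S x) := rfl

end Hp

section FBL

variable (p : ℝ≥0∞) [Fact (1 ≤ p)] (E : Type*) [NormedAddCommGroup E] [NormedSpace ℝ E]

/-- `FBL^p[E]`: the closed (linear) sublattice of `H^p[E]` generated by the evaluations `δ_x`,
`x ∈ E`, that is, the smallest closed linear sublattice that contains them. -/
noncomputable def FBL : Submodule ℝ (Hp p E) :=
  sInf {W | IsClosed (W : Set (Hp p E)) ∧ IsSublattice (W : Set (Hp p E)) ∧
    ∀ x, Hp.delta p x ∈ W}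

variable {p E}

theorem FBL_le {W : Submodule ℝ (Hp p E)} (h : IsClosed (W : Set (Hp p E)))
    (h' : IsSublattice (W : Set (Hp p E))) (hd : ∀ x, Hp.delta p x ∈ W) : FBL p E ≤ W :=
  sInf_le ⟨h, h', hd⟩

theorem isClosed_FBL : IsClosed (FBL p E : Set (Hp p E)) := by
  rw [FBL, Submodule.coe_sInf]
  exact isClosed_biInter fun W hW => hW.1

theorem isSublattice_FBL : IsSublattice (FBL p E : Set (Hp p E)) := by
  constructor
  · intro f hf g hg
    simp only [FBL, SetLike.mem_coe, Submodule.mem_sInf] at hf hg ⊢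
    exact fun W hW => hW.2.1.supClosed (hf W hW) (hg W hW)
  · intro f hf g hg
    simp only [FBL, SetLike.mem_coe, Submodule.mem_sInf] at hf hg ⊢
    exact fun W hW => hW.2.1.infClosed (hf W hW) (hg W hW)

theorem delta_mem_FBL (x : E) : Hp.delta p x ∈ FBL p E :=
  Submodule.mem_sInf.2 fun _ hW => hW.2.2 x

instance : Lattice (FBL p E) :=
  Subtype.lattice (fun _ _ hf hg => isSublattice_FBL.supClosed hf hg)
    (fun _ _ hf hg => isSublattice_FBL.infClosed hf hg)

instance : CompleteSpace (FBL p E) := isClosed_FBL.completeSpace_coe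

/-- The canonical map `δ^E : E → FBL^p[E]`, `x ↦ δ_x`. -/
def FBL.delta (p : ℝ≥0∞) [Fact (1 ≤ p)] (x : E) : FBL p E := ⟨Hp.delta p x, delta_mem_FBL x⟩

variable {F : Type*} [NormedAddCommGroup F] [NormedSpace ℝ F]

theorem compAdjoint_mem_FBL (S : E →L[ℝ] F) {f : Hp p E} (hf : f ∈ FBL p E) :
    Hp.compAdjoint p S f ∈ FBL p F := by
  have h : FBL p E ≤ (FBL p F).comap (Hp.compAdjoint p S : Hp p E →ₗ[ℝ] Hp p F) :=
    FBL_le (isClosed_FBL.preimage (Hp.compAdjoint p S).continuous)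
      ⟨fun f hf g hg => isSublattice_FBL.supClosed hf hg,
        fun f hf g hg => isSublattice_FBL.infClosed hf hg⟩
      (fun x => delta_mem_FBL (S x))
  exact h hf

/-- For a bounded linear operator `S : E → F`, there is a bounded lattice homomorphism
`T : FBL^p[E] → FBL^p[F]` with `T ∘ δ^E = δ^F ∘ S`, and it is unique. -/
theorem FBL.existsUnique_map (p : ℝ≥0∞) [Fact (1 ≤ p)] (S : E →L[ℝ] F) :
    ∃! T : FBL p E →L[ℝ] FBL p F,
      IsLatticeHom (T : FBL p E →ₗ[ℝ] FBL p F) ∧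
        ∀ x, T (FBL.delta p x) = FBL.delta p (S x) := by
  refine ⟨((Hp.compAdjoint p S).comp (FBL p E).subtypeL).codRestrict (FBL p F)
    (fun f => compAdjoint_mem_FBL S f.2), ⟨⟨fun _ _ => rfl, fun _ _ => rfl⟩, fun _ => rfl⟩, ?_⟩
  intro T hT
  have h : FBL p E ≤ (LinearMap.eqLocus (T : FBL p E →ₗ[ℝ] FBL p F)
      (((Hp.compAdjoint p S).comp (FBL p E).subtypeL).codRestrict (FBL p F)
        (fun f => compAdjoint_mem_FBL S f.2) : FBL p E →L[ℝ] FBL p F)).map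
      (FBL p E).subtype := by
    refine FBL_le ?_ ⟨?_, ?_⟩ ?_
    · rw [Submodule.map_coe]
      exact isClosed_FBL.isClosedEmbedding_subtypeVal.isClosedMap _
        (isClosed_eq T.continuous (ContinuousLinearMap.continuous _))
    · rintro _ ⟨f, hf, rfl⟩ _ ⟨g, hg, rfl⟩
      refine ⟨f ⊔ g, ?_, rfl⟩
      exact (hT.1.1 f g).trans (congrArg₂ (· ⊔ ·) hf hg)
    · rintro _ ⟨f, hf, rfl⟩ _ ⟨g, hg, rfl⟩
      refine ⟨f ⊓ g, ?_, rfl⟩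
      exact (hT.1.2 f g).trans (congrArg₂ (· ⊓ ·) hf hg)
    · exact fun x => ⟨FBL.delta p x, hT.2 x, rfl⟩
  ext1 f
  obtain ⟨g, hg, hgf⟩ := h f.2
  obtain rfl : g = f := Subtype.ext hgf
  exact hg

/-- The lattice homomorphism `S̄ : FBL^p[E] → FBL^p[F]` induced by a bounded linear operator
`S : E → F`: the unique one with `S̄ ∘ δ^E = δ^F ∘ S`. -/
noncomputable def FBL.map (p : ℝ≥0∞) [Fact (1 ≤ p)] (S : E →L[ℝ] F) : FBL p E →L[ℝ] FBL p F :=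
  (FBL.existsUnique_map p S).choose

theorem FBL.map_spec (S : E →L[ℝ] F) :
    IsLatticeHom (FBL.map p S : FBL p E →ₗ[ℝ] FBL p F) ∧
      ∀ x, FBL.map p S (FBL.delta p x) = FBL.delta p (S x) :=
  (FBL.existsUnique_map p S).choose_spec.1

/-- The induced lattice homomorphism is composition with the adjoint. -/
theorem FBL.coe_map (S : E →L[ℝ] F) (f : FBL p E) :
    (FBL.map p S f : Hp p F) = Hp.compAdjoint p S f := by
  rw [(FBL.existsUnique_map p S).unique (FBL.map_spec S)
    (y₂ := ((Hp.compAdjoint p S).comp (FBL p E).subtypeL).codRestrict (FBL p F)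
      (fun f => compAdjoint_mem_FBL S f.2)) ⟨⟨fun _ _ => rfl, fun _ _ => rfl⟩, fun _ => rfl⟩]
  rfl

end FBL

end FreeBanachLattice

namespace FreeBanachLattice

/-! ### Hölder's inequality with weights, uniformly in `q ≥ 1` -/

section Inequalities

/-! Between Banach spaces, an isomorphic embedding is the same as an operator bounded below, so (b)
and (c) are the inequality `‖f‖ ≤ C ‖f ∘ J*‖` on `FBL p E` and on `Hp p E`. Since `FBL.map p J` is a
restriction of `compAdjoint p J`, (c) gives (b). For (a) ⇒ (c), a tuple of weak norm at most one is
a contraction `E → ℓ_p^n`. The coordinates of an extension of norm at most `C`, divided by `C`, are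
admissible in the norm of `f ∘ J*`, and positive homogeneity gives the inequality.

The substance is (b) ⇒ (a). Let `ξ_j` be the coordinates of a contraction `S`. By Hahn–Banach
(`exists_extension_of_unitTensors`), `S` extends with norm at most `C` once `∑ ξ_j(x_j) ≤ C ∑ c_k`
whenever `(J x_j)_j = ∑ c_k a_k ⊗ z_k`, with `c_k ≥ 0`, `a_k` in the unit ball of `ℓ_{p'}^n` and
`‖z_k‖ ≤ 1`. This is `sum_apply_le_of_bounded_below`. Put `M = ∑ c_k` and `G(y) = (∑ c_k
|y(z_k)|^p)^{1/p}`. Hölder over `k` gives weights `b_j` with `|y(J x_j)| ≤ b_j G(y)` and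
`ℓ_{p'}`-norm at most `M^{1/p'}`. Hence `f = max_j |δ_{x_j}| / b_j`, an element of the free lattice,
satisfies `f ∘ J* ≤ G`, so that `‖f ∘ J*‖ ≤ M^{1/p}` and `‖f‖ ≤ C M^{1/p}`. Hölder over `j` then
yields `∑ ξ_j(x_j) ≤ ∑ b_j f(ξ_j) ≤ M^{1/p'} C M^{1/p} = C M`. -/

theorem sum_mul_rpow_sub_one_mul_le {ι : Type*} (s : Finset ι) {q : ℝ} (hq : 1 ≤ q)
    {c α ζ : ι → ℝ} (hc : ∀ i, 0 ≤ c i) (hα : ∀ i, 0 ≤ α i) (hζ : ∀ i, 0 ≤ ζ i) :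
    ∑ i ∈ s, c i * (α i ^ (q - 1) * ζ i) ≤
      (∑ i ∈ s, c i * α i ^ q) ^ ((q - 1) / q) * (∑ i ∈ s, c i * ζ i ^ q) ^ (1 / q) := by
  -- For `q = 1` the conjugate exponent is infinite, but `t ^ 0 = 1` for all `t`, including `0`,
  -- makes the two sides equal.
  rcases hq.eq_or_lt with rfl | hq
  · simp
  have hq0 : 0 < q := by linarith
  have hq1 : 0 < q - 1 := by linarith
  have hconj : (q / (q - 1)).HolderConjugate q := (Real.HolderConjugate.conjExponent hq).symm
  have hsum : (q - 1) / q + 1 / q = 1 := by field_simp; ring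
  -- The weight is split between the two factors as `c = c ^ ((q - 1) / q) * c ^ (1 / q)`.
  have h := Real.inner_le_Lp_mul_Lq_of_nonneg s hconj
    (f := fun i => c i ^ ((q - 1) / q) * α i ^ (q - 1)) (g := fun i => c i ^ (1 / q) * ζ i)
    (fun i _ => mul_nonneg (Real.rpow_nonneg (hc i) _) (Real.rpow_nonneg (hα i) _))
    (fun i _ => mul_nonneg (Real.rpow_nonneg (hc i) _) (hζ i))
  convert h using 1
  · refine Finset.sum_congr rfl fun i _ => ?_
    have : c i = c i ^ ((q - 1) / q) * c i ^ (1 / q) := by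
      rw [← Real.rpow_add_of_nonneg (hc i) (by positivity) (by positivity), hsum, Real.rpow_one]
    nth_rewrite 1 [this]
    ring
  · congr 2
    · refine Finset.sum_congr rfl fun i _ => ?_
      rw [Real.mul_rpow (Real.rpow_nonneg (hc i) _) (Real.rpow_nonneg (hα i) _),
        ← Real.rpow_mul (hc i), ← Real.rpow_mul (hα i)]
      rw [show (q - 1) / q * (q / (q - 1)) = 1 by field_simp,
        show (q - 1) * (q / (q - 1)) = q by field_simp, Real.rpow_one]
    · field_simp
    · refine Finset.sum_congr rfl fun i _ => ?_
      rw [Real.mul_rpow (Real.rpow_nonneg (hc i) _) (hζ i), ← Real.rpow_mul (hc i)]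
      rw [show 1 / q * q = 1 by field_simp, Real.rpow_one]

end Inequalities

/-! ### Hahn–Banach extension against the projective tensor norm -/

section Atoms

variable {ι F : Type*} [Fintype ι] [NormedAddCommGroup F] [NormedSpace ℝ F]

/-- The elementary tensors `a ⊗ z` with `‖z‖ ≤ 1` and `a` in the unit ball of the dual of
`ℓ_q(ι)`, where the latter is expressed by `|a| ≤ α ^ (q - 1)` for some `α ≥ 0` in the unit ball
of `ℓ_q(ι)`. -/
def unitTensors (q : ℝ) (ι F : Type*) [Fintype ι] [NormedAddCommGroup F] [NormedSpace ℝ F] :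
    Set (ι → F) :=
  {v | ∃ (α a : ι → ℝ) (z : F), (∀ j, 0 ≤ α j) ∧ ∑ j, α j ^ q ≤ 1 ∧
    (∀ j, |a j| ≤ α j ^ (q - 1)) ∧ ‖z‖ ≤ 1 ∧ v = fun j => a j • z}

theorem single_mem_unitTensors [DecidableEq ι] {q : ℝ} (hq : 1 ≤ q) (j : ι) {z : F}
    (hz : ‖z‖ ≤ 1) : Pi.single j z ∈ unitTensors q ι F := by
  refine ⟨Pi.single j 1, Pi.single j 1, z, fun i => ?_, le_of_eq ?_, fun i => ?_, hz, ?_⟩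
  · rcases eq_or_ne i j with rfl | h <;> simp [*]
  · rw [Finset.sum_eq_single j]
    · simp
    · intro i _ h
      simp [h, Real.zero_rpow (by linarith : q ≠ 0)]
    · simp
  · rcases eq_or_ne i j with rfl | h
    · simp
    · simpa [h] using Real.rpow_nonneg le_rfl _
  · funext i
    rcases eq_or_ne i j with rfl | h <;> simp [*]

/-- Duality of `ℓ_q` and `ℓ_{q'}`: a bound on elementary tensors is an operator norm bound. -/
theorem sum_rpow_le_of_unitTensors {q C : ℝ} (hq : 1 ≤ q) (hC : 0 ≤ C) {φ : ι → F →ₗ[ℝ] ℝ}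
    (h : ∀ v ∈ unitTensors q ι F, ∑ j, φ j (v j) ≤ C) {z : F} (hz : ‖z‖ ≤ 1) :
    (∑ j, |φ j z| ^ q) ^ (1 / q) ≤ C := by
  have hq0 : 0 < q := by linarith
  set T := (∑ j, |φ j z| ^ q) ^ (1 / q) with hT
  have hS0 : 0 ≤ ∑ j, |φ j z| ^ q := Finset.sum_nonneg fun j _ => by positivity
  have hTq : T ^ q = ∑ j, |φ j z| ^ q := by
    rw [hT, ← Real.rpow_mul hS0, one_div_mul_cancel hq0.ne', Real.rpow_one]
  have hT0 : 0 ≤ T := Real.rpow_nonneg hS0 _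
  rcases hT0.eq_or_lt with h0 | hpos
  · rwa [← h0]
  -- The extremal sequence in Hölder's inequality: paired with `(φ j z)_j` it gives exactly `T`.
  have key := h _ ⟨fun j => |φ j z| / T, fun j => SignType.sign (φ j z) * (|φ j z| / T) ^ (q - 1), z,
    fun j => by positivity, ?_, fun j => ?_, hz, rfl⟩
  · refine le_trans (le_of_eq ?_) key
    have h1 : ∀ j, φ j ((SignType.sign (φ j z) * (|φ j z| / T) ^ (q - 1) : ℝ) • z) =
        (|φ j z| ^ q) / T ^ (q - 1) := fun j => by
      rw [map_smul, smul_eq_mul, mul_right_comm, sign_mul_self, Real.div_rpow (abs_nonneg _) hT0,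
        mul_div_assoc']
      congr 1
      rcases (abs_nonneg (φ j z)).eq_or_lt with h0 | h0
      · rw [← h0, Real.zero_rpow hq0.ne', zero_mul]
      · rw [Real.rpow_sub_one h0.ne']
        field_simp
    rw [Finset.sum_congr rfl fun j _ => h1 j, ← Finset.sum_div, ← hTq, Real.rpow_sub_one hpos.ne']
    have := Real.rpow_pos_of_pos hpos q
    field_simp
  · simp_rw [Real.div_rpow (abs_nonneg _) hT0]
    rw [← Finset.sum_div, ← hTq, div_self (Real.rpow_pos_of_pos hpos q).ne']
  · have h2 : 0 ≤ (|φ j z| / T) ^ (q - 1) := by positivity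
    rw [abs_mul, abs_of_nonneg h2]
    refine mul_le_of_le_one_left h2 ?_
    rcases lt_trichotomy (φ j z) 0 with h | h | h <;> simp [h]

/-- The Hahn–Banach extension theorem for operators with values in `ℓ_q(ι)`. -/
theorem exists_extension_of_unitTensors {E : Type*} [AddCommGroup E] [Module ℝ E]
    {q C : ℝ} (hq : 1 ≤ q) (hC : 0 ≤ C) {J : E →ₗ[ℝ] F} (hJ : Function.Injective J)
    (ξ : ι → E →ₗ[ℝ] ℝ)
    (h : ∀ (x : ι → E) (m : ℕ) (c : Fin m → ℝ) (v : Fin m → ι → F), (∀ k, 0 ≤ c k) →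
      (∀ k, v k ∈ unitTensors q ι F) → (∀ j, J (x j) = ∑ k, c k • v k j) →
      ∑ j, ξ j (x j) ≤ C * ∑ k, c k) :
    ∃ φ : ι → F →ₗ[ℝ] ℝ, (∀ j x, φ j (J x) = ξ j x) ∧
      ∀ z, ‖z‖ ≤ 1 → (∑ j, |φ j z| ^ q) ^ (1 / q) ≤ C := by
  classical
  -- The second coordinate records the cost `∑ c k` of a representation, so the cone `K` over `A`
  -- replaces the epigraph of the projective norm. The hypothesis says that `L` is nonnegative where
  -- the range of `Φ` meets `K`.
  let A : Set ((ι → F) × ℝ) := {w | w.1 ∈ unitTensors q ι F ∧ w.2 = 1}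
  let K : PointedCone ℝ ((ι → F) × ℝ) := Submodule.span {c : ℝ // 0 ≤ c} A
  let Φ : (ι → E) × ℝ →ₗ[ℝ] (ι → F) × ℝ := (J.compLeft ι).prodMap LinearMap.id
  let L : (ι → E) × ℝ →ₗ[ℝ] ℝ :=
    C • LinearMap.snd ℝ _ _ - ∑ j, (ξ j ∘ₗ LinearMap.proj j) ∘ₗ LinearMap.fst ℝ (ι → E) ℝ
  have hL : ∀ u, L u = C * u.2 - ∑ j, ξ j (u.1 j) := fun u => by simp [L]
  have hΦ : Function.Injective Φ := by
    rintro ⟨x, s⟩ ⟨y, t⟩ hxy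
    simp only [Φ, LinearMap.prodMap_apply, Prod.mk.injEq, LinearMap.id_apply] at hxy
    exact Prod.ext (funext fun j => hJ (congrFun hxy.1 j)) hxy.2
  let f : (ι → F) × ℝ →ₗ.[ℝ] ℝ := ⟨Φ.range, L ∘ₗ (LinearEquiv.ofInjective Φ hΦ).symm⟩
  have hf : ∀ u (hu : Φ u ∈ f.domain), f ⟨Φ u, hu⟩ = L u := fun u hu => by
    change L ((LinearEquiv.ofInjective Φ hΦ).symm ⟨Φ u, hu⟩) = L u
    congr 1
    exact hΦ (LinearEquiv.ofInjective_symm_apply Φ _)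
  have hpos : ∀ x : f.domain, (x : (ι → F) × ℝ) ∈ K → 0 ≤ f x := by
    rintro ⟨_, ⟨⟨x, t⟩, rfl⟩⟩ hK
    refine le_of_le_of_eq ?_ (hf _ _).symm
    obtain ⟨m, c, w, hw⟩ := Submodule.mem_span_set'.1 hK
    have h2 : t = ∑ k, (c k : ℝ) := by
      have := congrArg Prod.snd hw
      rw [Prod.snd_sum] at this
      rw [show t = (Φ (x, t)).2 from rfl, ← this]
      refine Finset.sum_congr rfl fun k _ => ?_
      have := (w k).2.2
      change (c k : ℝ) * (w k : (ι → F) × ℝ).2 = _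
      rw [this, mul_one]
    have h1 := h x m (fun k => c k) (fun k => (w k : (ι → F) × ℝ).1) (fun k => (c k).2)
      (fun k => (w k).2.1) fun j => by
        have := congrFun (congrArg Prod.fst hw) j
        rw [Prod.fst_sum, Finset.sum_apply] at this
        exact this.symm
    rw [hL, h2]
    linarith
  -- The domain contains `0 × ℝ`, so it is enough that each `v` has some finite cost; decomposing
  -- into coordinates gives `∑ ‖v j‖`.
  have hdense : ∀ y : (ι → F) × ℝ, ∃ x : f.domain, (x : (ι → F) × ℝ) + y ∈ K := by
    rintro ⟨v, r⟩
    suffices H : ∃ s, (v, s) ∈ K by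
      obtain ⟨s, hs⟩ := H
      refine ⟨⟨Φ (0, s - r), LinearMap.mem_range_self _ _⟩, ?_⟩
      simpa [Φ] using hs
    have hmem : ∀ j, (Pi.single j (v j), ‖v j‖) ∈ K := fun j => by
      rcases eq_or_ne (v j) 0 with h0 | h0
      · rw [h0, Pi.single_zero, norm_zero]
        exact K.zero_mem
      · have h3 : (Pi.single j (‖v j‖⁻¹ • v j), (1 : ℝ)) ∈ K :=
          Submodule.subset_span ⟨single_mem_unitTensors hq j (by
            rw [norm_smul, norm_inv, norm_norm, inv_mul_cancel₀ (norm_ne_zero_iff.2 h0)]), rfl⟩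
        have h4 := K.smul_mem (norm_nonneg (v j)) h3
        convert h4 using 1
        refine Prod.ext ?_ (by simp)
        simp [← Pi.single_smul, smul_smul, norm_ne_zero_iff.2 h0]
    refine ⟨∑ j, ‖v j‖, ?_⟩
    have h5 := K.sum_mem (t := Finset.univ) fun j _ => hmem j
    have h6 : ∑ j, (Pi.single j (v j), ‖v j‖) = (v, ∑ j, ‖v j‖) := by
      refine Prod.ext ?_ ?_
      · rw [Prod.fst_sum]
        exact Finset.univ_sum_single v
      · rw [Prod.snd_sum]
    rwa [h6] at h5
  obtain ⟨g, hgf, hgK⟩ := riesz_extension K f hpos hdense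
  have hg : ∀ (x : ι → E) t, g (fun j => J (x j), t) = C * t - ∑ j, ξ j (x j) := fun x t =>
    (hgf ⟨Φ (x, t), LinearMap.mem_range_self _ _⟩).trans ((hf _ _).trans (hL _))
  -- As `g (v, t) = C * t - ∑ φ j (v j)`, positivity of `g` at `(v, 1)` is the bound on unit
  -- tensors.
  refine ⟨fun j => -(g ∘ₗ LinearMap.inl ℝ _ _ ∘ₗ LinearMap.single ℝ _ j), fun j x => ?_,
    fun z hz => sum_rpow_le_of_unitTensors hq hC (fun v hv => ?_) hz⟩
  · have h1 := hg (Pi.single j x) 0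
    have h2 : (fun i => J ((Pi.single j x : ι → E) i)) = Pi.single j (J x) := by
      funext i
      rcases eq_or_ne i j with rfl | hi <;> simp [*]
    have h3 : ∑ i, ξ i ((Pi.single j x : ι → E) i) = ξ j x := by
      rw [Finset.sum_eq_single j] <;> simp +contextual
    rw [h2, h3] at h1
    simp [h1]
  · have h1 := hgK (v, 1) (Submodule.subset_span ⟨hv, rfl⟩)
    have h2 : (v, (1 : ℝ)) = LinearMap.inl ℝ (ι → F) ℝ v + (0, 1) := by simp
    have h3 : g (0, 1) = C := by
      rw [show (0 : ι → F) = fun j => J ((0 : ι → E) j) by ext; simp, hg]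
      simp
    have h4 : v = ∑ j, LinearMap.single ℝ (fun _ : ι => F) j (v j) := by
      simp [Finset.univ_sum_single]
    rw [h2, map_add, h3, h4, map_sum, map_sum] at h1
    simp only [LinearMap.neg_apply, LinearMap.comp_apply, Finset.sum_neg_distrib]
    linarith

end Atoms

/-! ### Isomorphic embeddings as operators bounded below -/

section BoundedBelow

theorem isIsomorphicEmbedding_iff {X Y : Type*} [NormedAddCommGroup X] [NormedSpace ℝ X]
    [CompleteSpace X] [NormedAddCommGroup Y] [NormedSpace ℝ Y] [CompleteSpace Y] (T : X →L[ℝ] Y) :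
    IsIsomorphicEmbedding T ↔ ∃ C : ℝ, 1 ≤ C ∧ ∀ x, ‖x‖ ≤ C * ‖T x‖ := by
  constructor
  · rintro ⟨hi, hc⟩
    obtain ⟨K, hK⟩ := T.antilipschitz_of_injective_of_isClosed_range hi hc
    refine ⟨max K 1, le_max_right _ _, fun x => (T.bound_of_antilipschitz hK x).trans ?_⟩
    gcongr
    exact le_max_left _ _
  · rintro ⟨C, hC, h⟩
    have hT : AntilipschitzWith C.toNNReal T := T.antilipschitz_of_bound fun x => by
      rw [Real.coe_toNNReal C (by linarith)]
      exact h x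
    exact ⟨hT.injective, hT.isClosed_range T.uniformContinuous⟩

end BoundedBelow

/-! ### Finite suprema in the free lattice and norm estimates -/

section Majorants

variable {p : ℝ≥0∞} [Fact (1 ≤ p)] {E : Type*} [NormedAddCommGroup E] [NormedSpace ℝ E]

/-- The function is the finite supremum of the `|u j|`, started from `0` so that the empty family is
covered. -/
theorem exists_mem_FBL_isLUB_abs {ι : Type*} (s : Finset ι) {u : ι → Hp p E}
    (hu : ∀ j, u j ∈ FBL p E) :
    ∃ f ∈ FBL p E, (∀ x, 0 ≤ f x) ∧ (∀ j ∈ s, ∀ x, |u j x| ≤ f x) ∧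
      ∀ x B, 0 ≤ B → (∀ j ∈ s, |u j x| ≤ B) → f x ≤ B := by
  classical
  induction s using Finset.induction_on with
  | empty => exact ⟨0, zero_mem _, by simp, by simp, fun x B hB _ => by simpa using hB⟩
  | insert i s _ ih =>
    obtain ⟨f, hf, hf0, hle, hlub⟩ := ih
    refine ⟨f ⊔ |u i|, isSublattice_FBL.supClosed hf
      (isSublattice_FBL.supClosed (hu i) (neg_mem (hu i))), fun x => ?_, fun j hj x => ?_,
      fun x B hB h => ?_⟩
    · exact (hf0 x).trans le_sup_left
    · rcases Finset.mem_insert.1 hj with rfl | hj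
      · exact le_sup_right
      · exact (hle j hj x).trans le_sup_left
    · exact sup_le (hlub x B hB fun j hj => h j (Finset.mem_insert_of_mem hj))
        (h i (Finset.mem_insert_self _ _))

theorem norm_toLp_eq (hp : p ≠ ∞) {n : ℕ} (a : Fin n → ℝ) :
    ‖WithLp.toLp p a‖ = (∑ j, |a j| ^ p.toReal) ^ (1 / p.toReal) := by
  have h1 : 1 ≤ p := Fact.out
  rw [PiLp.norm_eq_sum (ENNReal.toReal_pos (zero_lt_one.trans_le h1).ne' hp)]
  rfl

theorem one_le_toReal (hp : p ≠ ∞) : 1 ≤ p.toReal := by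
  have h1 : 1 ≤ p := Fact.out
  simpa using ENNReal.toReal_mono hp h1

theorem norm_toLp_apply_le {n : ℕ} {xs : Fin n → StrongDual ℝ E} (hxs : weakNorm p xs ≤ 1)
    {x : E} (hx : ‖x‖ ≤ 1) : ‖WithLp.toLp p (fun j => xs j x)‖ ≤ 1 := by
  have h := (enorm_le_weakNorm xs hx).trans hxs
  rwa [← enorm_one (G := ℝ), enorm_le_iff_norm_le, norm_one] at h

theorem weakNorm_le_one {n : ℕ} {xs : Fin n → StrongDual ℝ E}
    (h : ∀ x, ‖x‖ ≤ 1 → ‖WithLp.toLp p (fun j => xs j x)‖ ≤ 1) : weakNorm p xs ≤ 1 := by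
  refine iSup_le fun x => iSup_le fun hx => ?_
  rw [← enorm_one (G := ℝ), enorm_le_iff_norm_le, norm_one]
  exact h x hx

/-- The norm of a function dominated by a weighted `ℓ_p`-sum of evaluations at unit vectors. -/
theorem norm_le_of_le_sum_rpow (hp : p ≠ ∞) {m : ℕ} {c : Fin m → ℝ} (hc : ∀ k, 0 ≤ c k)
    {z : Fin m → E} (hz : ∀ k, ‖z k‖ ≤ 1) {f : Hp p E}
    (h : ∀ y, |f y| ≤ (∑ k, c k * |y (z k)| ^ p.toReal) ^ (1 / p.toReal)) :
    ‖f‖ ≤ (∑ k, c k) ^ (1 / p.toReal) := by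
  have hq0 : 0 < p.toReal := zero_lt_one.trans_le (one_le_toReal hp)
  refine Hp.norm_le _ (Real.rpow_nonneg (Finset.sum_nonneg fun k _ => hc k) _) fun n ys hy => ?_
  rw [norm_toLp_eq hp]
  refine Real.rpow_le_rpow (Finset.sum_nonneg fun j _ => by positivity) ?_ (by positivity)
  -- After exchanging the sums, each inner sum over `j` is at most one by the weak norm of `ys`.
  calc ∑ j, |f (ys j)| ^ p.toReal ≤ ∑ j, ∑ k, c k * |ys j (z k)| ^ p.toReal := by
        refine Finset.sum_le_sum fun j _ => ?_
        have h0 : 0 ≤ ∑ k, c k * |ys j (z k)| ^ p.toReal :=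
          Finset.sum_nonneg fun k _ => mul_nonneg (hc k) (by positivity)
        refine (Real.rpow_le_rpow (abs_nonneg _) (h (ys j)) hq0.le).trans_eq ?_
        rw [← Real.rpow_mul h0, one_div_mul_cancel hq0.ne', Real.rpow_one]
    _ = ∑ k, c k * ∑ j, |ys j (z k)| ^ p.toReal := by
        rw [Finset.sum_comm]
        simp_rw [Finset.mul_sum]
    _ ≤ ∑ k, c k := by
        refine Finset.sum_le_sum fun k _ => mul_le_of_le_one_right (hc k) ?_
        have h1 := norm_toLp_apply_le hy (hz k)
        rw [norm_toLp_eq hp] at h1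
        by_contra! h2
        exact absurd (Real.one_lt_rpow h2 (one_div_pos.2 hq0)) h1.not_gt

end Majorants

/-! ### Extension of operators versus lower bounds for composition -/

section Extension

variable {p : ℝ≥0∞} [Fact (1 ≤ p)] {E F : Type*} [NormedAddCommGroup E] [NormedSpace ℝ E]
  [NormedAddCommGroup F] [NormedSpace ℝ F]

/-- If composition with `J*` is bounded below on `FBL^p[E]`, then tuples of weak `p`-summing norm
at most one are bounded on `E ⊗ ℓ_{p'}^n` with respect to the projective norm of
`F ⊗ ℓ_{p'}^n`. -/
theorem sum_apply_le_of_bounded_below (hp : p ≠ ∞) {J : E →L[ℝ] F} (hJ : Function.Injective J)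
    {C : ℝ} (hC : 0 ≤ C) (hbelow : ∀ f ∈ FBL p E, ‖f‖ ≤ C * ‖Hp.compAdjoint p J f‖)
    {n : ℕ} {ξ : Fin n → StrongDual ℝ E} (hξ : weakNorm p ξ ≤ 1) (x : Fin n → E) (m : ℕ)
    (c : Fin m → ℝ) (v : Fin m → Fin n → F) (hc : ∀ k, 0 ≤ c k)
    (hv : ∀ k, v k ∈ unitTensors p.toReal (Fin n) F) (hx : ∀ j, J (x j) = ∑ k, c k • v k j) :
    ∑ j, ξ j (x j) ≤ C * ∑ k, c k := by
  have hq := one_le_toReal hp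
  set q := p.toReal with hqdef
  have hq0 : 0 < q := by linarith
  choose α a z hα hα1 ha hz hvz using hv
  have hM : 0 ≤ ∑ k, c k := Finset.sum_nonneg fun k _ => hc k
  have hsq : ∀ j, 0 ≤ ∑ k, c k * α k j ^ q := fun j =>
    Finset.sum_nonneg fun k _ => mul_nonneg (hc k) (Real.rpow_nonneg (hα k j) _)
  -- `β` lies in the `ℓ_q`-ball of radius `(∑ c k) ^ (1 / q)`, and `b = β ^ (q - 1)` is the first
  -- Hölder factor in the bound of `|y (J (x j))|`. For `q = 1` every `b j` is `1`.
  let β : Fin n → ℝ := fun j => (∑ k, c k * α k j ^ q) ^ (1 / q)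
  have hβ0 : ∀ j, 0 ≤ β j := fun j => Real.rpow_nonneg (hsq j) _
  have hβq : ∀ j, β j ^ q = ∑ k, c k * α k j ^ q := fun j => by
    simp only [β]
    rw [← Real.rpow_mul (hsq j), one_div_mul_cancel hq0.ne', Real.rpow_one]
  let b : Fin n → ℝ := fun j => β j ^ (q - 1)
  have hb0 : ∀ j, 0 ≤ b j := fun j => Real.rpow_nonneg (hβ0 j) _
  have hb : ∀ j, b j = (∑ k, c k * α k j ^ q) ^ ((q - 1) / q) := fun j => by
    simp only [b, β]
    rw [← Real.rpow_mul (hsq j), one_div_mul_eq_div]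
  let G : StrongDual ℝ F → ℝ := fun y => (∑ k, c k * |y (z k)| ^ q) ^ (1 / q)
  have hG0 : ∀ y, 0 ≤ G y := fun y => Real.rpow_nonneg
    (Finset.sum_nonneg fun k _ => mul_nonneg (hc k) (Real.rpow_nonneg (abs_nonneg _) _)) _
  have hJx : ∀ j (y : StrongDual ℝ F), |y (J (x j))| ≤ b j * G y := fun j y => by
    rw [hx j, map_sum, hb j]
    refine (Finset.abs_sum_le_sum_abs _ _).trans (le_trans (Finset.sum_le_sum fun k _ => ?_)
      (sum_mul_rpow_sub_one_mul_le Finset.univ hq hc (fun k => hα k j)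
        fun k => abs_nonneg (y (z k))))
    rw [hvz k, map_smul, map_smul, smul_eq_mul, smul_eq_mul, abs_mul, abs_mul, abs_of_nonneg (hc k)]
    exact mul_le_mul_of_nonneg_left (mul_le_mul_of_nonneg_right (ha k j) (abs_nonneg _)) (hc k)
  -- When `b j = 0`, the convention `0⁻¹ = 0` drops the index `j` from the supremum. Nothing is
  -- lost: then `J (x j) = 0`, hence `x j = 0`.
  obtain ⟨f, hfmem, hf0, hfle, hflub⟩ := exists_mem_FBL_isLUB_abs Finset.univ
    (u := fun j => Hp.delta p ((b j)⁻¹ • x j)) fun j => delta_mem_FBL _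
  have hξf : ∀ j, ξ j (x j) ≤ b j * f (ξ j) := fun j => by
    rcases (hb0 j).eq_or_lt with h0 | h0
    · have h1 : J (x j) = 0 := SeparatingDual.eq_zero_of_forall_dual_eq_zero (R := ℝ) fun y => by
        have := hJx j y
        rw [← h0, zero_mul] at this
        exact abs_nonpos_iff.1 this
      rw [hJ (h1.trans (map_zero J).symm), map_zero, ← h0, zero_mul]
    · have h1 := (le_abs_self _).trans (hfle j (Finset.mem_univ j) (ξ j))
      rw [Hp.delta_apply, map_smul, smul_eq_mul, inv_mul_le_iff₀ h0] at h1
      exact h1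
  have hnorm : ‖Hp.compAdjoint p J f‖ ≤ (∑ k, c k) ^ (1 / q) := by
    refine norm_le_of_le_sum_rpow hp hc hz fun y => ?_
    rw [Hp.compAdjoint_apply, abs_of_nonneg (hf0 _)]
    refine hflub _ _ (hG0 y) fun j _ => ?_
    rw [Hp.delta_apply, map_smul, smul_eq_mul, abs_mul, abs_of_nonneg (inv_nonneg.2 (hb0 j))]
    rcases (hb0 j).eq_or_lt with h0 | h0
    · rw [← h0, inv_zero, zero_mul]
      exact hG0 y
    · rw [inv_mul_le_iff₀ h0]
      exact hJx j y
  have hβsum : ∑ j, β j ^ q ≤ ∑ k, c k := by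
    simp_rw [hβq]
    rw [Finset.sum_comm]
    refine Finset.sum_le_sum fun k _ => ?_
    rw [← Finset.mul_sum]
    exact mul_le_of_le_one_right (hc k) (hα1 k)
  have hβsum0 : 0 ≤ ∑ j, β j ^ q := Finset.sum_nonneg fun j _ => Real.rpow_nonneg (hβ0 j) _
  have hfξ : (∑ j, f (ξ j) ^ q) ^ (1 / q) ≤ C * (∑ k, c k) ^ (1 / q) := by
    have h1 := Hp.norm_toLp_le f hξ
    rw [norm_toLp_eq hp] at h1
    simp_rw [abs_of_nonneg (hf0 _)] at h1
    exact h1.trans ((hbelow f hfmem).trans (mul_le_mul_of_nonneg_left hnorm hC))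
  have hexp : (q - 1) / q + 1 / q = 1 := by field_simp; ring
  have hexp0 : 0 ≤ (q - 1) / q := div_nonneg (by linarith) hq0.le
  calc ∑ j, ξ j (x j) ≤ ∑ j, b j * f (ξ j) := Finset.sum_le_sum fun j _ => hξf j
    _ ≤ (∑ j, β j ^ q) ^ ((q - 1) / q) * (∑ j, f (ξ j) ^ q) ^ (1 / q) := by
        simpa using sum_mul_rpow_sub_one_mul_le Finset.univ hq (c := fun _ => 1)
          (fun _ => zero_le_one) hβ0 fun j => hf0 (ξ j)
    _ ≤ (∑ k, c k) ^ ((q - 1) / q) * (C * (∑ k, c k) ^ (1 / q)) :=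
        mul_le_mul (Real.rpow_le_rpow hβsum0 hβsum hexp0) hfξ
          (Real.rpow_nonneg (Finset.sum_nonneg fun j _ => Real.rpow_nonneg (hf0 _) _) _)
          (Real.rpow_nonneg hM _)
    _ = C * ∑ k, c k := by
        rw [mul_left_comm, ← Real.rpow_add_of_nonneg hM hexp0 (by positivity), hexp, Real.rpow_one]

/-- One half of the identification of contractions into `ℓ_p^n` with tuples of weak norm at most
one. -/
theorem weakNorm_coordinates_le_one {n : ℕ} {S : E →L[ℝ] PiLp p (fun _ : Fin n => ℝ)}
    (hS : ‖S‖ ≤ 1) :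
    weakNorm p (fun j => (PiLp.proj (𝕜 := ℝ) p (fun _ : Fin n => ℝ) j).comp S) ≤ 1 :=
  weakNorm_le_one fun x hx => (S.le_opNorm x).trans (by nlinarith [norm_nonneg x, norm_nonneg S])

theorem exists_extension_of_bounded_below (hp : p ≠ ∞) {J : E →L[ℝ] F}
    (hJ : Function.Injective J) {C : ℝ} (hC : 0 ≤ C)
    (hbelow : ∀ f ∈ FBL p E, ‖f‖ ≤ C * ‖Hp.compAdjoint p J f‖) {n : ℕ}
    (S : E →L[ℝ] PiLp p (fun _ : Fin n => ℝ)) :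
    ∃ S' : F →L[ℝ] PiLp p (fun _ : Fin n => ℝ), S = S'.comp J ∧ ‖S'‖ ≤ C * ‖S‖ := by
  -- Both the extension and its bound scale with `S`; the zero operator extends by zero.
  wlog hS : ‖S‖ = 1 generalizing S
  · rcases eq_or_ne S 0 with rfl | h0
    · exact ⟨0, by simp, by simp⟩
    · have hn := norm_ne_zero_iff.2 h0
      obtain ⟨S', h1, h2⟩ := this (‖S‖⁻¹ • S) (by
        rw [norm_smul, norm_inv, norm_norm, inv_mul_cancel₀ hn])
      refine ⟨‖S‖ • S', ?_, ?_⟩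
      · rw [ContinuousLinearMap.smul_comp, ← h1, smul_inv_smul₀ hn]
      · rw [norm_smul, norm_inv, norm_norm, inv_mul_cancel₀ hn] at h2
        rw [norm_smul, norm_norm, mul_comm]
        exact mul_le_mul_of_nonneg_right (by linarith) (norm_nonneg S)
  obtain ⟨φ, hφJ, hφ⟩ := exists_extension_of_unitTensors (J := (J : E →ₗ[ℝ] F))
    (one_le_toReal hp) hC hJ
    (fun j => ((PiLp.proj (𝕜 := ℝ) p (fun _ : Fin n => ℝ) j).comp S : E →ₗ[ℝ] ℝ))
    (sum_apply_le_of_bounded_below hp hJ hC hbelow (weakNorm_coordinates_le_one hS.le))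
  let T : F →ₗ[ℝ] PiLp p (fun _ : Fin n => ℝ) :=
    (WithLp.linearEquiv p ℝ (Fin n → ℝ)).symm.toLinearMap ∘ₗ LinearMap.pi φ
  have hT : ∀ y, T y = WithLp.toLp p (fun j => φ j y) := fun _ => rfl
  have hTb : ∀ y, ‖y‖ ≤ 1 → ‖T y‖ ≤ C := fun y hy => by
    rw [hT, norm_toLp_eq hp]
    exact hφ y hy
  have hTn : ∀ y, ‖T y‖ ≤ C * ‖y‖ := fun y => by
    rcases eq_or_ne y 0 with rfl | h0
    · simp
    · have hn := norm_pos_iff.2 h0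
      have h1 := hTb (‖y‖⁻¹ • y) (by rw [norm_smul, norm_inv, norm_norm, inv_mul_cancel₀ hn.ne'])
      rwa [map_smul, norm_smul, norm_inv, norm_norm, inv_mul_le_iff₀ hn, mul_comm] at h1
  refine ⟨T.mkContinuous C hTn, ?_, ?_⟩
  · ext x j
    exact (hφJ j x).symm
  · rw [hS, mul_one]
    exact T.mkContinuous_norm_le hC hTn

/-- An admissible tuple on `E` lifts through `J*`, up to the factor `C`, to an admissible tuple on
`F`: the coordinates of the extended operator. -/
theorem norm_le_mul_norm_compAdjoint {J : E →L[ℝ] F} {C : ℝ} (hC : 1 ≤ C)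
    (hext : ∀ (n : ℕ) (S : E →L[ℝ] PiLp p (fun _ : Fin n => ℝ)),
      ∃ S' : F →L[ℝ] PiLp p (fun _ : Fin n => ℝ), S = S'.comp J ∧ ‖S'‖ ≤ C * ‖S‖)
    (f : Hp p E) : ‖f‖ ≤ C * ‖Hp.compAdjoint p J f‖ := by
  have hC0 : 0 < C := by linarith
  refine Hp.norm_le _ (mul_nonneg hC0.le (norm_nonneg _)) fun n xs hxs => ?_
  let T : E →ₗ[ℝ] PiLp p (fun _ : Fin n => ℝ) :=
    (WithLp.linearEquiv p ℝ (Fin n → ℝ)).symm.toLinearMap ∘ₗ LinearMap.pi fun j => (xs j : E →ₗ[ℝ] ℝ)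
  have hTn : ∀ x, ‖T x‖ ≤ 1 * ‖x‖ := fun x => by
    rcases eq_or_ne x 0 with rfl | h0
    · simp
    · have hn := norm_pos_iff.2 h0
      have h1 : ‖T (‖x‖⁻¹ • x)‖ ≤ 1 := norm_toLp_apply_le hxs
        (by rw [norm_smul, norm_inv, norm_norm, inv_mul_cancel₀ hn.ne'])
      rwa [map_smul, norm_smul, norm_inv, norm_norm, inv_mul_le_iff₀ hn, mul_comm] at h1
  obtain ⟨S', hS', hn⟩ := hext n (T.mkContinuous 1 hTn)
  have hnorm : ‖C⁻¹ • S'‖ ≤ 1 := by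
    rw [norm_smul, norm_inv, Real.norm_of_nonneg hC0.le, inv_mul_le_iff₀ hC0]
    exact hn.trans (mul_le_mul_of_nonneg_left (T.mkContinuous_norm_le zero_le_one hTn) hC0.le)
  have h1 := Hp.norm_toLp_le (Hp.compAdjoint p J f) (weakNorm_coordinates_le_one hnorm)
  have h2 : ∀ j, J.precomp ℝ ((PiLp.proj (𝕜 := ℝ) p (fun _ : Fin n => ℝ) j).comp (C⁻¹ • S')) =
      C⁻¹ • xs j := fun j => by
    ext x
    have h3 : (S' (J x)) j = xs j x := (congrArg (fun S => (S x) j) hS').symm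
    simp [h3]
  have h4 : WithLp.toLp p (fun j => f (xs j)) =
      C • WithLp.toLp p (fun j => f (C⁻¹ • xs j)) := by
    ext j
    simp [f.posHom (inv_nonneg.2 hC0.le), mul_inv_cancel_left₀ hC0.ne']
  simp_rw [Hp.compAdjoint_apply, h2] at h1
  rw [h4, norm_smul, Real.norm_of_nonneg hC0.le]
  exact mul_le_mul_of_nonneg_left h1 hC0.le

end Extension

end FreeBanachLattice

theorem propositionp {E F : Type*} [NormedAddCommGroup E] [NormedSpace ℝ E] [CompleteSpace E]
    [NormedAddCommGroup F] [NormedSpace ℝ F] [CompleteSpace F]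
    (p : ℝ≥0∞) [Fact (1 ≤ p)] (hp : p ≠ ∞)
    (J : E →L[ℝ] F) (hJ : FreeBanachLattice.IsIsomorphicEmbedding J) :
    List.TFAE [
      ∃ C : ℝ, 1 ≤ C ∧ ∀ (n : ℕ) (S : E →L[ℝ] PiLp p (fun _ : Fin n => ℝ)),
        ∃ S' : F →L[ℝ] PiLp p (fun _ : Fin n => ℝ), S = S'.comp J ∧ ‖S'‖ ≤ C * ‖S‖,
      FreeBanachLattice.IsIsomorphicEmbedding (FreeBanachLattice.FBL.map p J),
      FreeBanachLattice.IsIsomorphicEmbedding (FreeBanachLattice.Hp.compAdjoint p J)] := by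
  rw [FreeBanachLattice.isIsomorphicEmbedding_iff, FreeBanachLattice.isIsomorphicEmbedding_iff]
  tfae_have 1 → 3 := fun ⟨C, hC, h⟩ =>
    ⟨C, hC, FreeBanachLattice.norm_le_mul_norm_compAdjoint hC h⟩
  tfae_have 3 → 2 := fun ⟨C, hC, h⟩ => ⟨C, hC, fun f => by
    have h1 := h f
    rw [← FreeBanachLattice.FBL.coe_map] at h1
    exact h1⟩
  -- The same constant `C` passes through all three implications.
  tfae_have 2 → 1 := fun ⟨C, hC, h⟩ => ⟨C, hC, fun n S =>
    FreeBanachLattice.exists_extension_of_bounded_below hp hJ.1 (zero_le_one.trans hC)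
      (fun f hf => by
        have h1 : ‖f‖ ≤ C * ‖(FreeBanachLattice.FBL.map p J ⟨f, hf⟩ : FreeBanachLattice.Hp p F)‖ :=
          h ⟨f, hf⟩
        rwa [FreeBanachLattice.FBL.coe_map] at h1) S⟩
  tfae_finish
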